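/- Let $R$ be a commutative ring with identity that is semi-primary, i.e. there is a nilpotent ideal $N$ of $R$ such that $R/N$ is semi-simple (then $N$ is the Jacobson radical of $R$). An $R$-module $M$ is called Gorenstein projective if $M\cong \operatorname{Im}(P_0\to P^0)$ for some exact sequence $\cdots\to P_1\to P_0\to P^0\to P^1\to\cdots$ of projective $R$-modules that remains exact under $\operatorname{Hom}_R(-,Q)$ for every projective $R$-module $Q$. The Gorenstein projective dimension $\operatorname{Gpd}_R(M)$ is the least $n\ge 0$ for which there is an exact sequence $0\to G_n\to\cdots\to G_0\to M\to 0$ with all $G_i$ Gorenstein projective ($\infty$ if there is no such $n$), and the Gorenstein global dimension of $R$ is $\sup\{\operatorname{Gpd}_R(M)\mid M \text{ an } R\text{-module}\}$. If the Gorenstein global dimension of $R$ is finite, then $R$ is quasi-Frobenius, i.e. $R$ is Noetherian and self-injective (injective as a module over itself). -/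

import Mathlib

universe u

/-- A complete projective resolution: a doubly infinite exact sequence
`⋯ → P i → P (i+1) → P (i+2) → ⋯` of projective left `R`-modules which stays exact under
`Hom_R(-, Q)` for every projective left `R`-module `Q`. -/
structure CompleteProjectiveResolution (R : Type u) [Ring R] where
  /-- the modules of the sequence -/
  P : ℤ → ModuleCat.{u} R
  /-- the differentials -/
  d : ∀ i : ℤ, P i →ₗ[R] P (i + 1)
  projective : ∀ i, Module.Projective R (P i)
  exact : ∀ i, Function.Exact (d i) (d (i + 1))
  hom_exact : ∀ (Q : Type u) [AddCommGroup Q] [Module R Q], Module.Projective R Q → ∀ i : ℤ,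
    Function.Exact (fun f : P (i + 1 + 1) →ₗ[R] Q => f ∘ₗ d (i + 1))
      (fun g : P (i + 1) →ₗ[R] Q => g ∘ₗ d i)

/-- `M` is Gorenstein projective: it is isomorphic to the image of a differential of a complete
projective resolution (by shifting, the choice of the differential is immaterial). -/
def IsGorensteinProjective (R : Type u) [Ring R] (M : Type u) [AddCommGroup M] [Module R M] :
    Prop :=
  ∃ C : CompleteProjectiveResolution R, Nonempty (M ≃ₗ[R] LinearMap.range (C.d 0))

/-- `HasGorensteinProjectiveResolution R n M`: there is an exact sequence
`0 → G_n → ⋯ → G_1 → G_0 → M → 0` with all `G_i` Gorenstein projective. For `n = 0` this says that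
`M ≅ G_0` is itself Gorenstein projective; for `n + 1` the sequence is split at the kernel
of `G_0 → M`. -/
def HasGorensteinProjectiveResolution (R : Type u) [Ring R] :
    ℕ → ∀ (M : Type u) [AddCommGroup M] [Module R M], Prop
  | 0, M, _, _ => IsGorensteinProjective R M
  | n + 1, M, _, _ => ∃ (G : ModuleCat.{u} R) (f : G →ₗ[R] M), IsGorensteinProjective R G ∧
      Function.Surjective f ∧ HasGorensteinProjectiveResolution R n (LinearMap.ker f)

/-- The Gorenstein projective dimension: the least length of a finite resolution by Gorenstein
projective modules, and `⊤` if there is none. -/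
noncomputable def gorensteinProjectiveDimension (R : Type u) [Ring R] (M : Type u)
    [AddCommGroup M] [Module R M] : ℕ∞ :=
  ⨅ (n : ℕ) (_ : HasGorensteinProjectiveResolution R n M), (n : ℕ∞)

/-- The (left) Gorenstein global dimension: the supremum of the Gorenstein projective dimensions of
all left `R`-modules. -/
noncomputable def gorensteinGlobalDimension (R : Type u) [Ring R] : ℕ∞ :=
  ⨆ M : ModuleCat.{u} R, gorensteinProjectiveDimension R M

/-- A quasi-Frobenius ring: (left) Noetherian and (left) self-injective. -/
structure IsQuasiFrobenius (R : Type u) [Ring R] : Prop where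
  noetherian : IsNoetherianRing R
  selfInjective : Module.Injective R R

/-!
The Gorenstein hypothesis enters only through the functors `Ext`. For a Gorenstein projective
module `G` and a projective module `Q`, `Ext i G Q = 0` for all `i > 0`; so if the Gorenstein global
dimension is at most `n`, dimension shifting gives `Ext (n + 1) M Q = 0` for *all* modules `M` and
all projective modules `Q` (`exists_forall_ext_subsingleton`).

Over a commutative semiprimary ring every maximal ideal is the annihilator of an element
(`exists_forall_mul_eq_zero_iff_mem`), so every simple module embeds in `R` and every semisimple
module embeds in a free module. If `S ↪ F` is such an embedding with cokernel `C`, the exact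
sequence `Ext (k + 1) F Q → Ext (k + 1) S Q → Ext (k + 2) C Q` shows that the vanishing of
`Ext (k + 2) _ Q` implies that of `Ext (k + 1) S Q`, for semisimple `S`; as every module is a finite
iterated extension of semisimple ones, `Ext (k + 1) _ Q` vanishes as well. Descending to degree `1`
shows that all projective modules are injective (`injective_of_forall_ext_subsingleton`).

In particular `R` is self-injective, and, containing all simple modules, it is a cogenerator. Hence
a strictly increasing sequence of ideals `I 0 < I 1 < ⋯` with union `U` would give elements `a i`
with `a i * I i = 0` and `a i * U ≠ 0`. The map `U → R^(ℕ)`, `x ↦ (x * a i)`, would extend to `R`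
because `R^(ℕ)` is injective, and so would have only finitely many nonzero coordinates, which is
absurd; thus `R` is Noetherian (`isNoetherianRing_of_injective_finsupp`).
-/

open CategoryTheory Abelian

/-! ### Exact sequences of `Ext` for linear maps -/

section ExtSequences

variable {R : Type u} [Ring R] {A B C : Type u} [AddCommGroup A] [AddCommGroup B] [AddCommGroup C]
  [Module R A] [Module R B] [Module R C] {f : A →ₗ[R] B} {g : B →ₗ[R] C} (Q : ModuleCat.{u} R)

theorem ext_subsingleton_middle (hf : Function.Injective f) (hfg : Function.Exact f g)
    (hg : Function.Surjective g) {k : ℕ} (hA : Subsingleton (Ext (ModuleCat.of R A) Q k))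
    (hC : Subsingleton (Ext (ModuleCat.of R C) Q k)) :
    Subsingleton (Ext (ModuleCat.of R B) Q k) := by
  have hS := ModuleCat.shortComplex_shortExact
    (ShortComplex.moduleCatMk f g hfg.linearMap_comp_eq_zero) hfg hf hg
  refine subsingleton_of_forall_eq 0 fun x ↦ ?_
  obtain ⟨y, rfl⟩ := Ext.contravariant_sequence_exact₂ hS Q x (hA.elim _ _)
  obtain rfl : y = 0 := hC.elim _ _
  exact Ext.comp_zero ..

theorem ext_subsingleton_left (hf : Function.Injective f) (hfg : Function.Exact f g)
    (hg : Function.Surjective g) {k : ℕ} (hB : Subsingleton (Ext (ModuleCat.of R B) Q k))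
    (hC : Subsingleton (Ext (ModuleCat.of R C) Q (k + 1))) :
    Subsingleton (Ext (ModuleCat.of R A) Q k) := by
  have hS := ModuleCat.shortComplex_shortExact
    (ShortComplex.moduleCatMk f g hfg.linearMap_comp_eq_zero) hfg hf hg
  refine subsingleton_of_forall_eq 0 fun x ↦ ?_
  obtain ⟨y, rfl⟩ := Ext.contravariant_sequence_exact₁ hS Q x (add_comm 1 k) (hC.elim _ _)
  obtain rfl : y = 0 := hB.elim _ _
  exact Ext.comp_zero ..

theorem ext_subsingleton_right (hf : Function.Injective f) (hfg : Function.Exact f g)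
    (hg : Function.Surjective g) {k : ℕ} (hA : Subsingleton (Ext (ModuleCat.of R A) Q k))
    (hB : Subsingleton (Ext (ModuleCat.of R B) Q (k + 1))) :
    Subsingleton (Ext (ModuleCat.of R C) Q (k + 1)) := by
  have hS := ModuleCat.shortComplex_shortExact
    (ShortComplex.moduleCatMk f g hfg.linearMap_comp_eq_zero) hfg hf hg
  refine subsingleton_of_forall_eq 0 fun x ↦ ?_
  obtain ⟨y, rfl⟩ := Ext.contravariant_sequence_exact₃ hS Q x (hB.elim _ _) (add_comm 1 k)
  obtain rfl : y = 0 := hA.elim _ _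
  exact Ext.comp_zero ..

/-- If every linear map `A → Q` extends along `A ↪ B` and `Ext 1 B Q = 0`, then the connecting map
`Hom A Q → Ext 1 C Q` is both zero and surjective. -/
theorem ext_one_subsingleton_right (hf : Function.Injective f) (hfg : Function.Exact f g)
    (hg : Function.Surjective g) (hext : ∀ φ : A →ₗ[R] Q, ∃ ψ : B →ₗ[R] Q, ψ ∘ₗ f = φ)
    (hB : Subsingleton (Ext (ModuleCat.of R B) Q 1)) :
    Subsingleton (Ext (ModuleCat.of R C) Q 1) := by
  let S := ShortComplex.moduleCatMk f g hfg.linearMap_comp_eq_zero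
  have hS : S.ShortExact := ModuleCat.shortComplex_shortExact S hfg hf hg
  refine subsingleton_of_forall_eq 0 fun x ↦ ?_
  obtain ⟨y, rfl⟩ := Ext.contravariant_sequence_exact₃ hS Q x (hB.elim _ _) (add_comm 1 0)
  obtain ⟨φ, rfl⟩ := Ext.homEquiv₀.symm.surjective y
  obtain ⟨ψ, hψ⟩ := hext φ.hom
  obtain ⟨ψ', rfl⟩ : ∃ ψ' : S.X₂ ⟶ Q, φ = S.f ≫ ψ' :=
    ⟨ModuleCat.ofHom ψ, ModuleCat.hom_ext hψ.symm⟩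
  rw [Ext.homEquiv₀_symm_apply, ← Ext.mk₀_comp_mk₀]
  exact hS.extClass_comp_assoc _

theorem ext_subsingleton_of_linearEquiv {k : ℕ} (e : A ≃ₗ[R] B)
    (hB : Subsingleton (Ext (ModuleCat.of R B) Q k)) :
    Subsingleton (Ext (ModuleCat.of R A) Q k) := by
  refine subsingleton_of_forall_eq 0 fun x ↦ ?_
  rw [← x.mk₀_id_comp, ← e.toModuleIso.hom_inv_id, ← Ext.mk₀_comp_mk₀_assoc,
    hB.elim ((Ext.mk₀ e.toModuleIso.inv).comp x _) 0, Ext.comp_zero]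

theorem ext_subsingleton_of_moduleProjective [Module.Projective R A] (k : ℕ) :
    Subsingleton (Ext (ModuleCat.of R A) Q (k + 1)) :=
  have := (IsProjective.iff_projective (R := R) A).mp ‹_›
  Ext.subsingleton_of_projective _ _ _

end ExtSequences

/-! ### Gorenstein projective modules and `Ext` -/

section Gorenstein

variable {R : Type u} [Ring R] (Q : ModuleCat.{u} R)

/-- The images `K j` of the differentials of a complete projective resolution fit into short exact
sequences `0 → K i → P (i + 1) → K (i + 1) → 0` with projective middle term, along which maps to
projective modules extend, by exactness under `Hom(-, Q)`. -/
theorem CompleteProjectiveResolution.ext_range_subsingleton (C : CompleteProjectiveResolution R)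
    (hQ : Module.Projective R Q) (k : ℕ) (j : ℤ) :
    Subsingleton (Ext (ModuleCat.of R (LinearMap.range (C.d j))) Q (k + 1)) := by
  -- `hom_exact` is stated for the consecutive differentials `d i` and `d (i + 1)`.
  obtain ⟨i, rfl⟩ : ∃ i, j = i + 1 + 1 := ⟨j - 2, by ring⟩
  have hinj : Function.Injective (LinearMap.range (C.d (i + 1))).subtype :=
    Submodule.injective_subtype _
  have hsurj := LinearMap.surjective_rangeRestrict (C.d (i + 1 + 1))
  have hex : Function.Exact (LinearMap.range (C.d (i + 1))).subtype
      (C.d (i + 1 + 1)).rangeRestrict := by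
    rw [LinearMap.exact_iff, LinearMap.ker_rangeRestrict, Submodule.range_subtype]
    exact LinearMap.exact_iff.mp (C.exact (i + 1))
  have := C.projective (i + 1 + 1)
  have hP (k : ℕ) : Subsingleton (Ext (ModuleCat.of R (C.P (i + 1 + 1))) Q (k + 1)) :=
    ext_subsingleton_of_moduleProjective Q k
  cases k with
  | zero =>
    refine ext_one_subsingleton_right Q hinj hex hsurj (fun φ ↦ ?_) (hP 0)
    obtain ⟨ψ, hψ⟩ := (C.hom_exact Q hQ i (φ ∘ₗ (C.d (i + 1)).rangeRestrict)).mp <| by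
      ext x
      have hx : (C.d (i + 1)).rangeRestrict (C.d i x) = 0 :=
        Subtype.ext ((C.exact i).apply_apply_eq_zero x)
      simp [hx]
    refine ⟨ψ, ?_⟩
    ext ⟨_, x, rfl⟩
    exact LinearMap.congr_fun hψ x
  | succ k =>
    exact ext_subsingleton_right Q hinj hex hsurj
      (C.ext_range_subsingleton hQ k (i + 1)) (hP (k + 1))

theorem HasGorensteinProjectiveResolution.ext_subsingleton (hQ : Module.Projective R Q) {n : ℕ}
    {M : Type u} [AddCommGroup M] [Module R M] (h : HasGorensteinProjectiveResolution R n M)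
    {k : ℕ} (hk : n ≤ k) : Subsingleton (Ext (ModuleCat.of R M) Q (k + 1)) := by
  induction n generalizing M k with
  | zero =>
    obtain ⟨C, ⟨e⟩⟩ := h
    exact ext_subsingleton_of_linearEquiv Q e (C.ext_range_subsingleton Q hQ k 0)
  | succ n ih =>
    obtain ⟨G, f, ⟨C, ⟨e⟩⟩, hf, hker⟩ := h
    obtain ⟨k, rfl⟩ : ∃ l, k = l + 1 := ⟨k - 1, by lia⟩
    exact ext_subsingleton_right Q (Submodule.injective_subtype _)
      (LinearMap.exact_subtype_ker_map f) hf (ih hker (by lia))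
      (ext_subsingleton_of_linearEquiv Q e (C.ext_range_subsingleton Q hQ _ 0))

theorem exists_forall_ext_subsingleton (hfin : gorensteinGlobalDimension R < ⊤) :
    ∃ n : ℕ, ∀ Q : ModuleCat.{u} R, Module.Projective R Q →
      ∀ (M : Type u) [AddCommGroup M] [Module R M],
        Subsingleton (Ext (ModuleCat.of R M) Q (n + 1)) := by
  obtain ⟨n, hn⟩ := ENat.ne_top_iff_exists.mp hfin.ne
  refine ⟨n, fun Q hQ M _ _ ↦ ?_⟩
  have hM : gorensteinProjectiveDimension R M < (n + 1 : ℕ) :=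
    (le_iSup (fun M : ModuleCat.{u} R ↦ gorensteinProjectiveDimension R M)
      (ModuleCat.of R M)).trans_lt (hn.symm.trans_lt (by exact_mod_cast n.lt_succ_self))
  obtain ⟨k, hk⟩ := iInf_lt_iff.mp hM
  obtain ⟨hres, hk⟩ := iInf_lt_iff.mp hk
  exact hres.ext_subsingleton Q hQ (Nat.lt_succ_iff.mp (by exact_mod_cast hk))

end Gorenstein

/-! ### Embedding semisimple modules in free modules -/

section Semiprimary

variable {R : Type u} [CommRing R] [IsSemiprimaryRing R]

/-- Semisimplicity of `R ⧸ J`, with `J` the Jacobson radical, provides `c ∉ m` with `c * m ≤ J`;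
nilpotence of `J` then provides a power `c ^ n ≠ 0` with `c ^ n * m ^ n = 0`, so the last nonzero
ideal among the `c ^ n * m ^ t` consists of elements killed by `m`. -/
theorem exists_forall_mul_eq_zero_iff_mem (m : Ideal R) [hm : m.IsMaximal] :
    ∃ a : R, ∀ r : R, r * a = 0 ↔ r ∈ m := by
  obtain ⟨n, hn⟩ := IsSemiprimaryRing.isNilpotent (R := R)
  have hJm : Ring.jacobson R ≤ m := by
    rw [← Ideal.jacobson_bot]
    exact sInf_le ⟨bot_le, hm⟩
  obtain ⟨c, hcm, hc⟩ : ∃ c ∉ m, ∀ x ∈ m, c * x ∈ Ring.jacobson R := by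
    obtain ⟨D, hD⟩ := exists_isCompl (m.map (Ideal.Quotient.mk (Ring.jacobson R)))
    obtain ⟨x, hx, d, hd, hxd⟩ := Submodule.mem_sup.mp
      (hD.sup_eq_top ▸ Submodule.mem_top : (1 : R ⧸ Ring.jacobson R) ∈ _)
    obtain ⟨c, rfl⟩ := Ideal.Quotient.mk_surjective d
    obtain ⟨y, hy, rfl⟩ :=
      (Ideal.mem_map_iff_of_surjective _ Ideal.Quotient.mk_surjective).mp hx
    refine ⟨c, fun hcm ↦ hm.ne_top ((Ideal.eq_top_iff_one m).mpr ?_), fun x hx ↦ ?_⟩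
    · rw [← map_add, ← map_one (Ideal.Quotient.mk _), Ideal.Quotient.mk_eq_mk_iff_sub_mem] at hxd
      simpa using m.sub_mem (m.add_mem hy hcm) (hJm hxd)
    · rw [← Ideal.Quotient.eq_zero_iff_mem, map_mul]
      exact (Submodule.mem_bot _).mp (hD.inf_eq_bot.le
        ⟨Ideal.mul_mem_left _ _ (Ideal.mem_map_of_mem _ hx), Ideal.mul_mem_right _ _ hd⟩)
  have hex : ∃ t, Ideal.span {c ^ n} * m ^ t = ⊥ := by
    refine ⟨n, le_bot_iff.mp ?_⟩
    rw [← Ideal.span_singleton_pow, ← mul_pow]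
    refine (Ideal.pow_right_mono ?_ n).trans hn.le
    exact Ideal.span_singleton_mul_le_iff.mpr hc
  classical
  obtain ⟨t, ht⟩ : ∃ t, Nat.find hex = t + 1 := by
    refine Nat.exists_eq_succ_of_ne_zero fun h0 ↦ hcm ?_
    have h := Nat.find_spec hex
    rw [h0, pow_zero, mul_one, Ideal.span_singleton_eq_bot] at h
    exact hm.isPrime.mem_of_pow_mem n (h ▸ m.zero_mem)
  obtain ⟨a, ha, ha0⟩ := Submodule.exists_mem_ne_zero_of_ne_bot
    (Nat.find_min hex (m := t) (by lia))
  have hmul (r : R) (hr : r ∈ m) : r * a = 0 := by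
    have h := Nat.find_spec hex
    rw [ht, pow_succ, ← mul_assoc] at h
    rw [mul_comm]
    exact (Submodule.mem_bot _).mp (h.le (Ideal.mul_mem_mul ha hr))
  refine ⟨a, fun r ↦ ⟨fun hr ↦ ?_, hmul r⟩⟩
  by_contra hrm
  obtain ⟨s, x, hx, hsx⟩ := hm.exists_inv hrm
  refine ha0 ?_
  rw [← one_mul a, ← hsx, add_mul, hmul x hx, mul_assoc, hr, mul_zero, add_zero]

theorem exists_injective_linearMap_of_isSimpleModule (M : Type*) [AddCommGroup M] [Module R M]
    [hM : IsSimpleModule R M] : ∃ f : M →ₗ[R] R, Function.Injective f := by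
  obtain ⟨m, hm, ⟨e⟩⟩ := isSimpleModule_iff_quot_maximal.mp hM
  obtain ⟨a, ha⟩ := exists_forall_mul_eq_zero_iff_mem m
  have hker : LinearMap.ker (LinearMap.toSpanSingleton R R a) = m := by
    ext r
    simp [ha]
  refine ⟨m.liftQ (LinearMap.toSpanSingleton R R a) hker.ge ∘ₗ e.toLinearMap, ?_⟩
  rw [LinearMap.coe_comp]
  refine Function.Injective.comp (LinearMap.ker_eq_bot.mp ?_) e.injective
  exact Submodule.ker_liftQ_eq_bot _ _ _ hker.le

theorem exists_injective_linearMap_finsupp (M : Type u) [AddCommGroup M] [Module R M]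
    [IsSemisimpleModule R M] :
    ∃ (ι : Type u) (f : M →ₗ[R] (ι →₀ R)), Function.Injective f := by
  classical
  obtain ⟨s, e, -, hs⟩ := IsSemisimpleModule.exists_linearEquiv_dfinsupp R M
  choose f hf using fun m : s ↦
    have := hs m
    exists_injective_linearMap_of_isSimpleModule (R := R) m.1
  refine ⟨s, (finsuppLequivDFinsupp R).symm.toLinearMap ∘ₗ DFinsupp.mapRange.linearMap f ∘ₗ
    e.toLinearMap, ?_⟩
  rw [LinearMap.coe_comp, LinearMap.coe_comp]
  refine (finsuppLequivDFinsupp R).symm.injective.comp (Function.Injective.comp ?_ e.injective)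
  exact (DFinsupp.mapRange_injective (fun m ↦ f m) fun m ↦ map_zero _).mpr hf

/-! ### Projective modules are injective -/

theorem forall_ext_subsingleton_of_succ (Q : ModuleCat.{u} R) {k : ℕ}
    (h : ∀ (M : Type u) [AddCommGroup M] [Module R M],
      Subsingleton (Ext (ModuleCat.of R M) Q (k + 2)))
    (M : Type u) [AddCommGroup M] [Module R M] :
    Subsingleton (Ext (ModuleCat.of R M) Q (k + 1)) := by
  refine IsSemiprimaryRing.induction R R M
    (P := fun M _ _ _ ↦ Subsingleton (Ext (ModuleCat.of R M) Q (k + 1))) ?_ ?_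
  · intro S _ _ _ _ _ _
    obtain ⟨ι, f, hf⟩ := exists_injective_linearMap_finsupp (R := R) S
    exact ext_subsingleton_left Q hf f.exact_map_mkQ_range (Submodule.mkQ_surjective _)
      (ext_subsingleton_of_moduleProjective Q k) (h _)
  · intro M _ _ _ _ N hN hMN
    exact ext_subsingleton_middle Q N.injective_subtype (LinearMap.exact_subtype_mkQ N)
      N.mkQ_surjective hN hMN

theorem injective_of_forall_ext_subsingleton (Q : ModuleCat.{u} R) {n : ℕ}
    (h : ∀ (M : Type u) [AddCommGroup M] [Module R M],
      Subsingleton (Ext (ModuleCat.of R M) Q (n + 1))) : Module.Injective R Q := by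
  induction n with
  | zero =>
    rw [Module.injective_iff_injective_object]
    exact injective_iff_subsingleton_ext_one.mpr fun M ↦ h M
  | succ n ih => exact ih fun M ↦ forall_ext_subsingleton_of_succ Q h M

/-! ### The Noetherian property -/

/-- A self-injective commutative semiprimary ring is a cogenerator: the cyclic submodule of `R ⧸ I`
generated by the class of `x` has a simple quotient, which embeds in `R`, and the resulting map
extends to a map `R ⧸ I → R` that does not vanish at `x`. In terms of elements, every ideal is the
annihilator of a subset of `R`. -/
theorem exists_forall_mul_eq_zero_and_mul_ne_zero (hinj : Module.Injective R R) {I : Ideal R}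
    {x : R} (hx : x ∉ I) : ∃ a : R, (∀ r ∈ I, r * a = 0) ∧ x * a ≠ 0 := by
  let g : R →ₗ[R] R ⧸ I := LinearMap.toSpanSingleton R (R ⧸ I) (I.mkQ x)
  have hg : (LinearMap.ker g : Ideal R) ≠ ⊤ := fun h ↦ hx <| by
    have h1 : (1 : R) ∈ LinearMap.ker g := h ▸ Submodule.mem_top
    simpa [g, Ideal.Quotient.eq_zero_iff_mem] using h1
  obtain ⟨m, hm, hgm⟩ := Ideal.exists_le_maximal _ hg
  obtain ⟨b, hb⟩ := exists_forall_mul_eq_zero_iff_mem m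
  have hgb : LinearMap.ker g ≤ LinearMap.ker (LinearMap.toSpanSingleton R R b) := fun r hr ↦
    by simpa using (hb r).mpr (hgm hr)
  obtain ⟨φ, hφ⟩ := hinj.out ((LinearMap.ker g).liftQ g le_rfl)
    (LinearMap.ker_eq_bot.mp (Submodule.ker_liftQ_eq_bot _ _ _ le_rfl))
    ((LinearMap.ker g).liftQ _ hgb)
  have hφ' (y : R) : φ (I.mkQ y) = y * φ (I.mkQ 1) := by
    rw [← smul_eq_mul, ← map_smul, ← map_smul, smul_eq_mul, mul_one]
  refine ⟨φ (I.mkQ 1), fun r hr ↦ ?_, fun h0 ↦ ?_⟩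
  · have hr' : I.mkQ r = 0 := (Submodule.Quotient.mk_eq_zero I).mpr hr
    rw [← hφ', hr', map_zero]
  · have h1 : φ (I.mkQ x) = b := by
      have h := hφ ((LinearMap.ker g).mkQ 1)
      rw [Submodule.mkQ_apply, Submodule.liftQ_apply, Submodule.liftQ_apply] at h
      simpa only [g, LinearMap.toSpanSingleton_apply, one_smul] using h
    rw [← hφ', h1] at h0
    exact hm.ne_top ((Ideal.eq_top_iff_one m).mpr ((hb 1).mp (by rw [h0, mul_zero])))

theorem isNoetherianRing_of_injective_finsupp (hR : Module.Injective R R)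
    (hinj : Module.Injective R (ULift.{u} ℕ →₀ R)) : IsNoetherianRing R := by
  refine monotone_stabilizes_iff_noetherian.mp fun I ↦ ?_
  let U : Ideal R := ⨆ n, I n
  have hU (x : R) : x ∈ U ↔ ∃ n, x ∈ I n := Submodule.mem_iSup_of_directed _ I.monotone.directed_le
  by_contra! hI
  have hlt (n : ℕ) : ∃ x ∈ U, x ∉ I n := by
    obtain ⟨k, hnk, hne⟩ := hI n
    obtain ⟨x, hx, hxn⟩ := SetLike.exists_of_lt (lt_of_le_of_ne (I.monotone hnk) hne)
    exact ⟨x, (hU x).mpr ⟨k, hx⟩, hxn⟩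
  choose x hxU hxI using hlt
  choose a haI hax using fun n ↦ exists_forall_mul_eq_zero_and_mul_ne_zero hR (hxI n)
  -- An element of `U` lies in some `I k`, hence is killed by `a n` for all `n ≥ k`.
  have hfin (y : U) : (Function.support fun n : ULift.{u} ℕ ↦ (y : R) * a n.down).Finite := by
    obtain ⟨k, hk⟩ := (hU y).mp y.2
    refine ((Set.finite_Iio k).preimage ULift.down_injective.injOn).subset fun n hn ↦ ?_
    by_contra hkn
    exact hn (haI n.down y (I.monotone (not_lt.mp hkn) hk))
  let f : U →ₗ[R] (ULift.{u} ℕ →₀ R) :=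
    { toFun := fun y ↦ Finsupp.ofSupportFinite _ (hfin y)
      map_add' := fun y z ↦ by
        ext n
        simp [Finsupp.ofSupportFinite_coe, add_mul]
      map_smul' := fun r y ↦ by
        ext n
        simp [Finsupp.ofSupportFinite_coe, mul_assoc] }
  obtain ⟨g, hg⟩ := hinj.out U.subtype U.injective_subtype f
  obtain ⟨n, hn⟩ := Infinite.exists_notMem_finset (g 1).support
  refine hax n.down ?_
  calc x n.down * a n.down = f ⟨_, hxU n.down⟩ n := rfl
    _ = g (x n.down • 1) n := by rw [← hg]; simp
    _ = 0 := by rw [map_smul, Finsupp.smul_apply, Finsupp.notMem_support_iff.mp hn, smul_zero]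

end Semiprimary

theorem mainTheorem5 (R : Type u) [CommRing R] (hR : IsSemiprimaryRing R)
    (hfin : gorensteinGlobalDimension R < ⊤) : IsQuasiFrobenius R := by
  obtain ⟨n, hn⟩ := exists_forall_ext_subsingleton hfin
  have hinj (Q : Type u) [AddCommGroup Q] [Module R Q] (hQ : Module.Projective R Q) :
      Module.Injective R Q :=
    injective_of_forall_ext_subsingleton (ModuleCat.of R Q) (hn (ModuleCat.of R Q) hQ)
  exact ⟨isNoetherianRing_of_injective_finsupp (hinj R inferInstance)
    (hinj _ inferInstance), hinj R inferInstance⟩
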